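/- Let $X=\{0,1,S\}^{\mathbb N}$, with the product topology, the distance $d(x,y)=2^{-\min\{n\,:\,x_n\ne y_n\}}$, the shift $\sigma(x)_n=x_{n+1}$, and the configurations $w0^\infty$ ($w$ a finite word) as ideal points. In a computable metric space (a metric space with a dense sequence of ideal points whose mutual distances are uniformly computable) let $(B_m)_m$ be a computable enumeration of the open balls with ideal centre and positive rational radius, and let $\overline{B}_m$ be the closed ball with the same centre and radius. A map $T$ is computable if $T^{-1}(B_m)$ is, uniformly in $m$, a recursively enumerable union of balls $B_n$. The outer collection of a compact set $K$ is $\{m : \overline{B}_m\cap K=\emptyset\}$; $K$ is $\Pi_2$ if its outer collection is a $\Sigma_2$ set of integers, and $\Pi_2$-complete if moreover, for every $\Pi_2$ compact set $K'$ of a computable metric space, the outer collection of $K'$ is enumeration reducible to that of $K$ (one algorithm turns every enumeration of the outer collection of $K$ into an enumeration of that of $K'$). For a map $T:X\to X$ let $\omega(x)$ be the set of accumulation points of $(T^n(x))_{n\ge 0}$, and for $A\subset X$ let $\rho(A)=\{x\in X:\omega(x)\subset A\}$. A closed set $A\subset X$ is a topological attractor of $T$ if $\rho(A)$ is comeagre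 and $\rho(A')$ is meagre for every closed $A'\subsetneq A$; it is a metric attractor of $T$ with respect to a probability measure $\mu$ if $\rho(A)$ has full $\mu$-measure and $\rho(A')$ is $\mu$-null for every closed $A'\subsetneq A$. Theorem. There exist a computable map $T:X\to X$ and a set $A\subset X$ such that: 1. $A$ is a subshift (closed, with $\sigma(A)\subset A$), and it is $T$-invariant: $T(A)=A$; 2. $A$ is $\Pi_2$-complete; moreover the set $\mathrm{Tot}$ of indices of the programs that halt on every input is many-one reducible to $\{m:\overline{B}_m\cap A\neq\emptyset\}$; 3. $A$ is the unique topological attractor of $T$; 4. for every $\sigma$-ergodic Borel probability measure $\mu$ on $X$ of full support, $A$ is the unique metric attractor of $T$ with respect to $\mu$. -/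

import Mathlib

open Filter Topology MeasureTheory

/-! ### Level two of the arithmetical hierarchy and reductions between sets of naturals -/

/-- `S` is `Σ₂`: `i ∈ S ↔ ∃ a, ∀ b, f (i, a, b) = 1` with `f` computable. -/
def IsSigmaTwoSet (S : Set ℕ) : Prop :=
  ∃ f : ℕ × ℕ × ℕ → Bool, Computable f ∧ ∀ i, i ∈ S ↔ ∃ a, ∀ b, f (i, a, b) = true

/-- Enumeration reducibility: a fixed algorithm turns every enumeration of `B` into an enumeration
of `A`. The algorithm is an r.e. set `W` of axioms `(n, L)`, read as "enumerate `n` once all the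
members of the finite list `L` have been enumerated". -/
def EnumReducible (A B : Set ℕ) : Prop :=
  ∃ W : ℕ × List ℕ → Prop, REPred W ∧ ∀ n, n ∈ A ↔ ∃ L, W (n, L) ∧ ∀ m ∈ L, m ∈ B

/-- The (codes of) programs that halt on every input. -/
def Tot : Set ℕ :=
  {i | ∀ n, ((Denumerable.ofNat Nat.Partrec.Code i).eval n).Dom}

/-! ### Computable metric spaces -/

/-- A computable metric space: a metric space with a dense sequence of ideal points whose mutual
distances are uniformly computable. The rational approximation of the (nonnegative) distance is
given as a numerator `a` and a denominator `b + 1`. -/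
structure ComputableMetricSpace (X : Type) extends MetricSpace X where
  pt : ℕ → X
  dense_pt : DenseRange pt
  computable_dist : ∃ f : ℕ × ℕ × ℕ → ℕ × ℕ, Computable f ∧ ∀ i j n : ℕ,
    |dist (pt i) (pt j) - ((f (i, j, n)).1 : ℝ) / ((f (i, j, n)).2 + 1)| ≤ (1 / 2) ^ n

namespace ComputableMetricSpace

/-- The radius of the `m`-th ideal ball. The index `m = ⟨i, ⟨p, q⟩⟩` codes the ball centred at the
`i`-th ideal point with the positive rational radius `(p + 1) / (q + 1)`. -/
noncomputable def idealRadius (m : ℕ) : ℝ :=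
  ((m.unpair.2.unpair.1 : ℝ) + 1) / ((m.unpair.2.unpair.2 : ℝ) + 1)

variable {X Y : Type}

/-- The `m`-th (open) ideal ball. -/
def idealBall (C : ComputableMetricSpace X) (m : ℕ) : Set X :=
  @Metric.ball X C.toPseudoMetricSpace (C.pt m.unpair.1) (idealRadius m)

/-- The `m`-th closed ideal ball. -/
def closedIdealBall (C : ComputableMetricSpace X) (m : ℕ) : Set X :=
  @Metric.closedBall X C.toPseudoMetricSpace (C.pt m.unpair.1) (idealRadius m)

/-- `T` is computable: the preimage of the `m`-th ideal ball is the union of a family of ideal balls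
that is recursively enumerable uniformly in `m`. -/
def ComputableMap (C : ComputableMetricSpace X) (D : ComputableMetricSpace Y) (T : X → Y) : Prop :=
  ∃ W : ℕ × ℕ → Prop, REPred W ∧ ∀ m, T ⁻¹' D.idealBall m = ⋃ n ∈ {n | W (m, n)}, C.idealBall n

/-- The outer collection of `K`: the indices of the closed ideal balls that do not meet `K`. -/
def outer (C : ComputableMetricSpace X) (K : Set X) : Set ℕ :=
  {m | C.closedIdealBall m ∩ K = ∅}

/-- A `Π₂` compact set: its outer collection is `Σ₂` (so the collection of the closed ideal balls
that meet it is `Π₂`). -/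
def IsPiTwo (C : ComputableMetricSpace X) (K : Set X) : Prop :=
  @IsCompact X C.toUniformSpace.toTopologicalSpace K ∧ IsSigmaTwoSet (C.outer K)

/-- A `Π₂`-complete compact set: it is `Π₂`, and for every `Π₂` compact set `K'` (in any computable
metric space), an enumeration of the outer collection of `K'` can be computed from any enumeration
of the outer collection of `K`. -/
def IsPiTwoComplete (C : ComputableMetricSpace X) (K : Set X) : Prop :=
  C.IsPiTwo K ∧ ∀ (Y : Type) (D : ComputableMetricSpace Y) (K' : Set Y),
    D.IsPiTwo K' → EnumReducible (D.outer K') (C.outer K)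

end ComputableMetricSpace

/-! ### Attractors -/

section Attractors

variable {X : Type} [TopologicalSpace X]

/-- `ω(x)`: the accumulation points of the sequence `x, T x, T² x, …`. -/
def omegaSet (T : X → X) (x : X) : Set X :=
  {y | MapClusterPt y atTop (fun n : ℕ => T^[n] x)}

/-- The realm of topological attraction `ρ(A)`. -/
def realm (T : X → X) (A : Set X) : Set X :=
  {x | omegaSet T x ⊆ A}

def IsTopologicalAttractor (T : X → X) (A : Set X) : Prop :=
  IsClosed A ∧ realm T A ∈ residual X ∧
    ∀ A' : Set X, IsClosed A' → A' ⊂ A → IsMeagre (realm T A')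

def IsMetricAttractor [MeasurableSpace X] (μ : Measure X) (T : X → X) (A : Set X) : Prop :=
  IsClosed A ∧ (∀ᵐ x ∂μ, x ∈ realm T A) ∧
    ∀ A' : Set X, IsClosed A' → A' ⊂ A → μ (realm T A') = 0

end Attractors

/-! ### The symbolic space `{0, 1, S}^ℕ` -/

/-- Configurations over the alphabet `{0, 1, S}`, the letter `S` being represented by `2`. The
topology is the product topology and the σ-algebra is the product (= Borel) σ-algebra. -/
abbrev Config : Type := ℕ → Fin 3

def shift (x : Config) : Config := fun n => x (n + 1)

/-- A subshift: a closed shift-invariant set. -/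
def IsSubshift (A : Set Config) : Prop :=
  IsClosed A ∧ Set.MapsTo shift A A

/-- The `i`-th ideal point of the symbolic space: the word of the base-three digits of `i`, least
significant first, followed by `0^∞`. Every configuration `w 0^∞` is one of these. -/
def idealConfig (i : ℕ) : Config := fun n => Fin.ofNat 3 (i / 3 ^ n)

theorem idealConfig_approx (n : ℕ) (x : Config) : ∃ i, ∀ k < n, idealConfig i k = x k := by
  induction n generalizing x with
  | zero => exact ⟨0, by simp⟩
  | succ n ih =>
    obtain ⟨i, hi⟩ := ih (shift x)
    refine ⟨(x 0 : ℕ) + 3 * i, fun k hk => ?_⟩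
    rcases k with _ | k
    · apply Fin.ext
      have := (x 0).isLt
      simp only [idealConfig, Fin.val_ofNat, pow_zero, Nat.div_one]
      omega
    · have h := hi k (by omega)
      have e : ((x 0 : ℕ) + 3 * i) / 3 ^ (k + 1) = i / 3 ^ k := by
        rw [pow_succ', ← Nat.div_div_eq_div_mul]
        congr 1
        have := (x 0).isLt
        omega
      simp only [idealConfig] at h ⊢
      rw [e, h]
      rfl

theorem idealConfig_agree_iff (n i j : ℕ) :
    (∀ k < n, idealConfig i k = idealConfig j k) ↔ i % 3 ^ n = j % 3 ^ n := by
  induction n with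
  | zero => simp [Nat.mod_one]
  | succ n ih =>
    have key : ∀ m : ℕ, m % 3 ^ (n + 1) = m % 3 ^ n + 3 ^ n * (m / 3 ^ n % 3) := fun m => by
      rw [pow_succ, Nat.mod_mul]
    have hp : 0 < 3 ^ n := by positivity
    have hlast : idealConfig i n = idealConfig j n ↔ i / 3 ^ n % 3 = j / 3 ^ n % 3 := by
      simp [idealConfig, Fin.ext_iff]
    constructor
    · intro h
      rw [key, key, ih.1 fun k hk => h k (by omega), hlast.1 (h n (by omega))]
    · intro h
      have h1 : i % 3 ^ n = j % 3 ^ n := by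
        have := congrArg (· % 3 ^ n) h
        simpa [Nat.mod_mod_of_dvd _ (pow_dvd_pow 3 (Nat.le_succ n))] using this
      intro k hk
      rcases Nat.lt_succ_iff_lt_or_eq.1 hk with hk | rfl
      · exact ih.2 h1 k hk
      · rw [hlast]
        rw [key, key, h1] at h
        exact Nat.eq_of_mul_eq_mul_left hp (by omega)

theorem primrec_three_pow : Primrec fun n : ℕ => 3 ^ n :=
  (Primrec.nat_rec₁ (f := fun _ y => 3 * y) 1
    (Primrec.nat_mul.comp (Primrec.const 3) Primrec.snd)).of_eq fun n => by
      induction n with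
      | zero => rfl
      | succ n ih => simp only [ih, pow_succ']

theorem primrec_two_pow : Primrec fun n : ℕ => 2 ^ n :=
  (Primrec.nat_rec₁ (f := fun _ y => 2 * y) 1
    (Primrec.nat_mul.comp (Primrec.const 2) Primrec.snd)).of_eq fun n => by
      induction n with
      | zero => rfl
      | succ n ih => simp only [ih, pow_succ']

theorem idealConfig_computable_dist :
    ∃ f : ℕ × ℕ × ℕ → ℕ × ℕ, Computable f ∧ ∀ i j n : ℕ,
      |PiNat.dist.dist (idealConfig i) (idealConfig j)
        - ((f (i, j, n)).1 : ℝ) / ((f (i, j, n)).2 + 1)| ≤ (1 / 2) ^ n := by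
  let g : ℕ × ℕ × ℕ → ℕ := fun p =>
    Nat.findGreatest (fun k => p.1 % 3 ^ k = p.2.1 % 3 ^ k) p.2.2
  have hg : Primrec g := by
    refine Primrec.nat_findGreatest (p := fun (p : ℕ × ℕ × ℕ) (k : ℕ) =>
      p.1 % 3 ^ k = p.2.1 % 3 ^ k) (Primrec.snd.comp Primrec.snd) ?_
    exact Primrec.eq.comp
      (Primrec.nat_mod.comp (Primrec.fst.comp Primrec.fst) (primrec_three_pow.comp Primrec.snd))
      (Primrec.nat_mod.comp (Primrec.fst.comp (Primrec.snd.comp Primrec.fst))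
        (primrec_three_pow.comp Primrec.snd))
  refine ⟨fun p => (1, 2 ^ g p - 1), ?_, fun i j n => ?_⟩
  · exact ((Primrec.const 1).pair
      (Primrec.nat_sub.comp (primrec_two_pow.comp hg) (Primrec.const 1))).to_comp
  · let _ : Dist Config := PiNat.dist
    have hval : (((1 : ℕ) : ℝ)) / (((2 ^ g (i, j, n) - 1 : ℕ) : ℝ) + 1) =
        (1 / 2) ^ g (i, j, n) := by
      have h1 : (((2 ^ g (i, j, n) - 1 : ℕ) : ℝ) + 1) = 2 ^ g (i, j, n) := by
        have h := Nat.sub_add_cancel (Nat.one_le_two_pow (n := g (i, j, n)))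
        exact_mod_cast h
      rw [h1]
      simp
    change |dist (idealConfig i) (idealConfig j) - _| ≤ _
    rw [hval]
    have hle : g (i, j, n) ≤ n := Nat.findGreatest_le n
    have hagree : i % 3 ^ g (i, j, n) = j % 3 ^ g (i, j, n) :=
      Nat.findGreatest_spec (P := fun k => i % 3 ^ k = j % 3 ^ k) (Nat.zero_le n)
        (by simp [Nat.mod_one])
    have hd : dist (idealConfig i) (idealConfig j) ≤ (1 / 2) ^ g (i, j, n) :=
      PiNat.mem_cylinder_iff_dist_le.1 ((idealConfig_agree_iff _ _ _).2 hagree)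
    have hd0 : 0 ≤ dist (idealConfig i) (idealConfig j) := PiNat.dist_nonneg _ _
    rcases hle.eq_or_lt with he | hlt
    · rw [he] at hd ⊢
      rw [abs_le]
      constructor <;> linarith
    · have hn : ¬ dist (idealConfig i) (idealConfig j) < (1 / 2) ^ g (i, j, n) := by
        intro hlt'
        have hk : i % 3 ^ (g (i, j, n) + 1) = j % 3 ^ (g (i, j, n) + 1) :=
          (idealConfig_agree_iff _ _ _).1 fun k hk =>
            PiNat.apply_eq_of_dist_lt hlt' (Nat.lt_succ_iff.1 hk)
        have := Nat.le_findGreatest (P := fun k => i % 3 ^ k = j % 3 ^ k) hlt hk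
        exact absurd this (Nat.not_succ_le_self _)
      have he : dist (idealConfig i) (idealConfig j) = (1 / 2) ^ g (i, j, n) :=
        le_antisymm hd (not_lt.1 hn)
      rw [he, sub_self, abs_zero]
      positivity

/-- The symbolic space `{0, 1, S}^ℕ` as a computable metric space: the distance is
`d(x, y) = 2^{-min {n | x n ≠ y n}}` and the ideal points are the configurations `w 0^∞`. -/
noncomputable def symbolicSpace : ComputableMetricSpace Config where
  toMetricSpace := PiNat.metricSpace
  pt := idealConfig
  dense_pt := by
    let _ : MetricSpace Config := PiNat.metricSpace
    rw [Metric.denseRange_iff]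
    intro x r hr
    obtain ⟨n, hn⟩ := exists_pow_lt_of_lt_one hr (by norm_num : (1 / 2 : ℝ) < 1)
    obtain ⟨i, hi⟩ := idealConfig_approx n x
    refine ⟨i, lt_of_le_of_lt ?_ hn⟩
    exact PiNat.mem_cylinder_iff_dist_le.1 fun k hk => (hi k hk).symm
  computable_dist := idealConfig_computable_dist

/-- The metric of `symbolicSpace` induces the product topology. -/
theorem symbolicSpace_topology :
    symbolicSpace.toUniformSpace.toTopologicalSpace = Pi.topologicalSpace := rfl

/-! ### Computability of the symbolic space and a complete computable sequence -/

/-! A primitive recursive 0-1 sequence v, `totSequence`, contains each word 1 0^i 1 infinitely often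
exactly when program i is total. Let A be its limit set `limitSubshift`, the configurations all of
whose prefixes recur forever in v.

The map T, `appendShift v`, treats the first S as the end of a finite word: it drops the first
letter of that word and appends the next two letters of v, reading its place in v from the word's
length, so the word grows by one. The initial word is thus flushed out, and T^n(x) displays ever
longer windows of v, ever further along (`iterate_appendShift`). Hence ω(x) = A for every x
containing S (`omegaSet_appendShift`). These x form a dense open set, of full measure under every
ergodic measure of full support, which makes A the attractor in both senses. A contains no S, so T
acts on it as the shift, which maps A onto itself.

A closed ball misses A iff from some index on no window of v lies in it, a Σ₂ condition. The
cylinder of 1 0^i 1 meets A iff i is in `Tot`, and `Tot` is Π₂-hard, whence completeness. -/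

/-- Distances are powers of 1/2, so only the letters k with 2^{-k} above the radius are constrained.
Since 2^k > k, none of these lies beyond the denominator of the radius; the bounded quantifier makes
membership of ideal points decidable. -/
theorem mem_closedIdealBall_symbolicSpace {m : ℕ} {y : Config} :
    y ∈ symbolicSpace.closedIdealBall m ↔ ∀ k < m.unpair.2.unpair.2 + 1,
      m.unpair.2.unpair.2 + 1 ≤ 2 ^ k * (m.unpair.2.unpair.1 + 1) ∨
        y k = idealConfig m.unpair.1 k := by
  let _ : MetricSpace Config := PiNat.metricSpace
  change dist y (idealConfig m.unpair.1) ≤ _ ↔ _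
  have key : ∀ k : ℕ, ((1 / 2 : ℝ) ^ k ≤ ComputableMetricSpace.idealRadius m ↔
      m.unpair.2.unpair.2 + 1 ≤ 2 ^ k * (m.unpair.2.unpair.1 + 1)) := fun k => by
    rw [ComputableMetricSpace.idealRadius, one_div, inv_pow, inv_le_comm₀ (by positivity)
      (by positivity), inv_div, div_le_iff₀ (by positivity)]
    exact_mod_cast Iff.rfl
  have hpos : 0 ≤ ComputableMetricSpace.idealRadius m := by
    unfold ComputableMetricSpace.idealRadius; positivity
  by_cases hy : y = idealConfig m.unpair.1
  · simp [hy, hpos]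
  have hd : dist y (idealConfig m.unpair.1) = (1 / 2 : ℝ) ^ PiNat.firstDiff y _ :=
    PiNat.dist_eq_of_ne hy
  rw [hd, key]
  constructor
  · intro h k _
    rcases lt_or_ge k (PiNat.firstDiff y (idealConfig m.unpair.1)) with hk | hk
    · exact .inr (PiNat.apply_eq_of_lt_firstDiff hk)
    · exact .inl (h.trans (Nat.mul_le_mul_right _ (Nat.pow_le_pow_right two_pos hk)))
  · intro h
    by_cases hk : PiNat.firstDiff y (idealConfig m.unpair.1) < m.unpair.2.unpair.2 + 1
    · exact (h _ hk).resolve_right (PiNat.apply_firstDiff_ne hy)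
    · have := Nat.lt_two_pow_self (n := PiNat.firstDiff y (idealConfig m.unpair.1))
      nlinarith

theorem mem_idealBall_symbolicSpace {m : ℕ} {y : Config} :
    y ∈ symbolicSpace.idealBall m ↔ ∀ k < m.unpair.2.unpair.2 + 1,
      m.unpair.2.unpair.2 + 1 < 2 ^ k * (m.unpair.2.unpair.1 + 1) ∨
        y k = idealConfig m.unpair.1 k := by
  let _ : MetricSpace Config := PiNat.metricSpace
  change dist y (idealConfig m.unpair.1) < _ ↔ _
  have key : ∀ k : ℕ, ((1 / 2 : ℝ) ^ k < ComputableMetricSpace.idealRadius m ↔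
      m.unpair.2.unpair.2 + 1 < 2 ^ k * (m.unpair.2.unpair.1 + 1)) := fun k => by
    rw [ComputableMetricSpace.idealRadius, one_div, inv_pow, inv_lt_comm₀ (by positivity)
      (by positivity), inv_div, div_lt_iff₀ (by positivity)]
    exact_mod_cast Iff.rfl
  have hpos : 0 < ComputableMetricSpace.idealRadius m := by
    unfold ComputableMetricSpace.idealRadius; positivity
  by_cases hy : y = idealConfig m.unpair.1
  · simp [hy, hpos]
  have hd : dist y (idealConfig m.unpair.1) = (1 / 2 : ℝ) ^ PiNat.firstDiff y _ :=
    PiNat.dist_eq_of_ne hy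
  rw [hd, key]
  constructor
  · intro h k _
    rcases lt_or_ge k (PiNat.firstDiff y (idealConfig m.unpair.1)) with hk | hk
    · exact .inr (PiNat.apply_eq_of_lt_firstDiff hk)
    · exact .inl (h.trans_le (Nat.mul_le_mul_right _ (Nat.pow_le_pow_right two_pos hk)))
  · intro h
    by_cases hk : PiNat.firstDiff y (idealConfig m.unpair.1) < m.unpair.2.unpair.2 + 1
    · exact (h _ hk).resolve_right (PiNat.apply_firstDiff_ne hy)
    · have h1 := Nat.lt_two_pow_self (n := PiNat.firstDiff y (idealConfig m.unpair.1))
      nlinarith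

/-- The index of the cylinder of length `n` around the `i`-th ideal configuration. -/
def cylinderIndex (i n : ℕ) : ℕ := Nat.pair i (Nat.pair 0 (2 ^ n - 1))

theorem idealRadius_cylinderIndex (i n : ℕ) :
    ComputableMetricSpace.idealRadius (cylinderIndex i n) = (1 / 2) ^ n := by
  simp [ComputableMetricSpace.idealRadius, cylinderIndex]

theorem mem_closedIdealBall_cylinderIndex {i n : ℕ} {y : Config} :
    y ∈ symbolicSpace.closedIdealBall (cylinderIndex i n) ↔ ∀ k < n, y k = idealConfig i k := by
  let _ : MetricSpace Config := PiNat.metricSpace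
  change dist y (idealConfig (cylinderIndex i n).unpair.1) ≤ _ ↔ _
  rw [idealRadius_cylinderIndex, ← PiNat.mem_cylinder_iff_dist_le]
  simp [cylinderIndex, PiNat.cylinder]

/-- The strict inequality fixes one letter more than the closed ball of the same index. -/
theorem mem_idealBall_cylinderIndex {i n : ℕ} {y : Config} :
    y ∈ symbolicSpace.idealBall (cylinderIndex i n) ↔ ∀ k ≤ n, y k = idealConfig i k := by
  let _ : MetricSpace Config := PiNat.metricSpace
  change dist y (idealConfig (cylinderIndex i n).unpair.1) < _ ↔ _
  rw [idealRadius_cylinderIndex]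
  simp only [cylinderIndex, Nat.unpair_pair]
  refine ⟨fun h k hk => PiNat.apply_eq_of_dist_lt h hk, fun h => ?_⟩
  refine (PiNat.mem_cylinder_iff_dist_le.1 fun k hk => h k (Nat.lt_succ_iff.1 hk)).trans_lt ?_
  exact pow_lt_pow_right_of_lt_one₀ (by norm_num) (by norm_num) (Nat.lt_succ_self n)

theorem primrec₂_idealConfig : Primrec₂ idealConfig := by
  have h : Primrec fun r : ℕ => (Fin.ofNat 3 (r % 3) : Fin 3) :=
    ((Primrec.dom_finite (id : Fin 3 → Fin 3)).comp
      (Primrec.ite (c := fun r : ℕ => r % 3 = 0)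
        (Primrec.eq.comp (Primrec.nat_mod.comp Primrec.id (Primrec.const 3)) (Primrec.const 0))
        (Primrec.const 0)
        (Primrec.ite (c := fun r : ℕ => r % 3 = 1)
          (Primrec.eq.comp (Primrec.nat_mod.comp Primrec.id (Primrec.const 3)) (Primrec.const 1))
          (Primrec.const 1) (Primrec.const 2)))).of_eq fun r => by
      have : r % 3 < 3 := Nat.mod_lt _ (by norm_num)
      apply Fin.ext
      rcases (by omega : r % 3 = 0 ∨ r % 3 = 1 ∨ r % 3 = 2) with h | h | h <;> simp [h]
  refine (h.comp (Primrec.nat_div.comp Primrec.fst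
    (primrec_three_pow.comp Primrec.snd))).of_eq fun p => ?_
  simp [idealConfig, Fin.ext_iff]

theorem PrimrecRel.forall_lt_param {α : Type*} [Primcodable α] {R : ℕ → α → Prop}
    (hR : PrimrecRel R) : PrimrecRel fun n a => ∀ k < n, R k a :=
  (hR.forall_mem_list.comp (Primrec.list_range.comp Primrec.fst) Primrec.snd).of_eq (by simp)

/-! ### Halting stages and the sequence that records them. -/

/-- The first `n + 1` inputs make program `i` halt within `s` steps. -/
def HaltsWithin (i n s : ℕ) : Prop :=
  ∀ j < n + 1, (Nat.Partrec.Code.evaln s (Denumerable.ofNat Nat.Partrec.Code i) j).isSome = true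

theorem HaltsWithin.mono {i n s t : ℕ} (h : HaltsWithin i n s) (hst : s ≤ t) :
    HaltsWithin i n t := fun j hj => by
  obtain ⟨a, ha⟩ := Option.isSome_iff_exists.1 (h j hj)
  exact Option.isSome_iff_exists.2 ⟨a, Nat.Partrec.Code.evaln_mono hst ha⟩

theorem not_haltsWithin_zero (i n : ℕ) : ¬ HaltsWithin i n 0 := fun h => by
  simpa [Nat.Partrec.Code.evaln] using h 0 (Nat.succ_pos n)

theorem mem_tot_iff {i : ℕ} : i ∈ Tot ↔ ∀ n, ∃ s, HaltsWithin i n s := by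
  constructor
  · intro h n
    have h' : ∀ j, ∃ s, (Nat.Partrec.Code.evaln s
        (Denumerable.ofNat Nat.Partrec.Code i) j).isSome = true := fun j => by
      obtain ⟨a, ha⟩ := Part.dom_iff_mem.1 (h j)
      obtain ⟨s, hs⟩ := Nat.Partrec.Code.evaln_complete.1 ha
      exact ⟨s, Option.isSome_iff_exists.2 ⟨a, hs⟩⟩
    choose s hs using h'
    refine ⟨(Finset.range (n + 1)).sup s, fun j hj => ?_⟩
    obtain ⟨a, ha⟩ := Option.isSome_iff_exists.1 (hs j)
    exact Option.isSome_iff_exists.2 ⟨a, Nat.Partrec.Code.evaln_mono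
      (Finset.le_sup (f := s) (Finset.mem_range.2 hj)) ha⟩
  · intro h n
    obtain ⟨s, hs⟩ := h n
    obtain ⟨a, ha⟩ := Option.isSome_iff_exists.1 (hs n (Nat.lt_succ_self n))
    exact Part.dom_iff_mem.2 ⟨a, Nat.Partrec.Code.evaln_sound ha⟩

/-- At stage `k = ⟨i, ⟨n, s⟩⟩`, program `i` is first seen to halt on all inputs up to `n`. -/
def Emits (k : ℕ) : Prop :=
  HaltsWithin k.unpair.1 k.unpair.2.unpair.1 (k.unpair.2.unpair.2 + 1) ∧
    ¬ HaltsWithin k.unpair.1 k.unpair.2.unpair.1 k.unpair.2.unpair.2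

theorem primrecPred_haltsWithin :
    PrimrecPred fun p : ℕ × ℕ × ℕ => HaltsWithin p.1 p.2.1 p.2.2 := by
  have h : PrimrecRel fun (j : ℕ) (p : ℕ × ℕ × ℕ) => (Nat.Partrec.Code.evaln p.2.2
      (Denumerable.ofNat Nat.Partrec.Code p.1) j).isSome = true :=
    Primrec.eq.comp (Primrec.option_isSome.comp (Nat.Partrec.Code.primrec_evaln.comp
      (((Primrec.snd.comp (Primrec.snd.comp Primrec.snd)).pair
        ((Primrec.ofNat _).comp (Primrec.fst.comp Primrec.snd))).pair Primrec.fst)))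
      (Primrec.const true)
  have h' := h.forall_lt_param
  exact h'.comp (Primrec.succ.comp (Primrec.fst.comp Primrec.snd)) Primrec.id

theorem primrecPred_emits : PrimrecPred Emits := by
  have h1 : Primrec fun k : ℕ => k.unpair.1 := Primrec.fst.comp Primrec.unpair
  have h2 : Primrec fun k : ℕ => k.unpair.2 := Primrec.snd.comp Primrec.unpair
  exact (primrecPred_haltsWithin.comp
      (h1.pair ((h1.comp h2).pair (Primrec.succ.comp (h2.comp h2))))).and
    (primrecPred_haltsWithin.comp (h1.pair ((h1.comp h2).pair (h2.comp h2)))).not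

/-- Program `i` is total iff it is emitted infinitely often. -/
theorem mem_tot_iff_frequently_emits {i : ℕ} :
    i ∈ Tot ↔ ∃ᶠ k in atTop, Emits k ∧ k.unpair.1 = i := by
  classical
  rw [Nat.frequently_atTop_iff_infinite, mem_tot_iff]
  constructor
  · intro h
    have h' : ∀ n, ∃ s, HaltsWithin i n (s + 1) ∧ ¬ HaltsWithin i n s := fun n => by
      have hs := Nat.find_spec (h n)
      rcases e : Nat.find (h n) with _ | s
      · rw [e] at hs; exact absurd hs (not_haltsWithin_zero i n)
      · exact ⟨s, e ▸ hs, Nat.find_min (h n) (by omega)⟩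
    choose s hs using h'
    -- A total program gives one emission for each n, at the first successful step count.
    refine Set.infinite_of_injective_forall_mem (f := fun n => Nat.pair i (Nat.pair n (s n)))
      (fun a b hab => ?_) fun n => ?_
    · simp only [Nat.pair_eq_pair] at hab
      exact hab.2.1
    · simpa [Emits] using hs n
  · intro h
    by_contra! hn
    obtain ⟨n, hn⟩ := hn
    -- If the inputs up to n never all halt, emissions of i have second coordinate below n, and that
    -- coordinate determines the stage because the first halting time is unique.
    refine h (Set.Finite.of_finite_image (f := fun k : ℕ => k.unpair.2.unpair.1)
      ((Set.finite_lt_nat n).subset ?_) ?_)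
    · rintro _ ⟨k, ⟨⟨hk, _⟩, rfl⟩, rfl⟩
      by_contra hle
      exact hn _ fun j hj => hk j (by simp only [Set.mem_ofPred_eq] at hle; omega)
    · rintro k ⟨⟨hk, hk'⟩, hki⟩ l ⟨⟨hl, hl'⟩, hli⟩ (hkl : k.unpair.2.unpair.1 = l.unpair.2.unpair.1)
      rw [hki, hkl] at hk hk'
      rw [hli] at hl hl'
      have e : k.unpair.2.unpair.2 = l.unpair.2.unpair.2 := by
        rcases lt_trichotomy k.unpair.2.unpair.2 l.unpair.2.unpair.2 with h | h | h
        · exact absurd (hk.mono h) hl'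
        · exact h
        · exact absurd (hl.mono h) hk'
      rw [← Nat.pair_unpair k, ← Nat.pair_unpair l, ← Nat.pair_unpair k.unpair.2,
        ← Nat.pair_unpair l.unpair.2, hki, hli, hkl, e]

open Classical in
/-- In the interval `[k², (k+1)²)`, the sequence carries the word `1 0^i 1` if stage `k` emits `i`,
and only zeros otherwise. -/
noncomputable def totSequence (j : ℕ) : Fin 3 :=
  if Emits j.sqrt ∧ (j = j.sqrt * j.sqrt ∨ j = j.sqrt * j.sqrt + j.sqrt.unpair.1 + 1) then 1 else 0

theorem totSequence_ne_two (j : ℕ) : totSequence j ≠ 2 := by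
  unfold totSequence
  split_ifs <;> decide

theorem totSequence_eq_one {j : ℕ} : totSequence j = 1 ↔
    Emits j.sqrt ∧ (j = j.sqrt * j.sqrt ∨ j = j.sqrt * j.sqrt + j.sqrt.unpair.1 + 1) := by
  unfold totSequence
  split_ifs with h <;> simp [h]

theorem totSequence_eq_zero {j : ℕ} : totSequence j = 0 ↔ totSequence j ≠ 1 := by
  unfold totSequence
  split_ifs with h <;> simp

theorem primrec_totSequence : Primrec totSequence := by
  classical
  have hs := Primrec.nat_sqrt
  have hss := Primrec.nat_mul.comp hs hs
  refine Primrec.ite ((primrecPred_emits.comp hs).and ((Primrec.eq.comp Primrec.id hss).or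
    (Primrec.eq.comp Primrec.id (Primrec.succ.comp (Primrec.nat_add.comp hss
      ((Primrec.fst.comp Primrec.unpair).comp hs)))))) (Primrec.const 1) (Primrec.const 0)

/-- An ideal point starting with the word `1 0^i 1`. -/
theorem idealConfig_delimited (i k : ℕ) :
    idealConfig (1 + 3 ^ (i + 1)) k = if k = 0 ∨ k = i + 1 then 1 else 0 := by
  have h3 : 3 ^ (i + 1) = 3 * 3 ^ i := pow_succ' 3 i
  apply Fin.ext
  rcases k with _ | k
  · simp only [idealConfig, Fin.val_ofNat, pow_zero, Nat.div_one, true_or, if_true]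
    change _ = 1
    omega
  have e : (1 + 3 ^ (i + 1)) / 3 ^ (k + 1) = 3 ^ i / 3 ^ k := by
    rw [pow_succ' 3 k, ← Nat.div_div_eq_div_mul, h3]
    congr 1
    omega
  simp only [idealConfig, Fin.val_ofNat, e, Nat.succ_ne_zero, false_or, Nat.add_right_cancel_iff]
  rcases lt_trichotomy k i with h | h | h
  · rw [if_neg h.ne, Nat.pow_div h.le (by norm_num)]
    obtain ⟨d, hd⟩ : ∃ d, i - k = d + 1 := ⟨i - k - 1, by omega⟩
    rw [hd, pow_succ]
    simp
  · subst h
    simp [Nat.div_self (show 0 < 3 ^ k by positivity)]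
  · rw [if_neg h.ne', Nat.div_eq_of_lt (Nat.pow_lt_pow_right (by norm_num) h)]
    simp

theorem sqrt_mul_self_add {k r : ℕ} (h : r ≤ 2 * k) : (k * k + r).sqrt = k :=
  Nat.sqrt_add_eq k (by omega)

/-- The code i is at most k, so the 1s of block k lie in its first k + 2 places and the gap to the
next block grows with k: far out, no 1 0^i 1 straddles two blocks. -/
theorem mem_tot_iff_frequently_totSequence {i : ℕ} :
    i ∈ Tot ↔ ∃ᶠ n in atTop, ∀ k < i + 2, totSequence (n + k) = idealConfig (1 + 3 ^ (i + 1)) k := by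
  rw [mem_tot_iff_frequently_emits]
  constructor
  · intro h
    rw [frequently_atTop] at h ⊢
    intro a
    -- A positive stage k ensures i + 1 ≤ 2k, so the word fits in its block.
    obtain ⟨k, hk, he, rfl⟩ := h (a + 1)
    have hle := Nat.unpair_left_le k
    refine ⟨k * k, by nlinarith, fun l hl => ?_⟩
    rw [idealConfig_delimited]
    split_ifs with hc
    · rw [totSequence_eq_one, sqrt_mul_self_add (by omega)]
      exact ⟨he, by omega⟩
    · rw [totSequence_eq_zero, Ne, totSequence_eq_one, sqrt_mul_self_add (by omega)]
      omega
  · intro h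
    rw [frequently_atTop] at h ⊢
    intro a
    -- Beyond this bound the block number is at least i + 2, so both 1s fall in one block.
    obtain ⟨n, hn, hw⟩ := h ((a + i + 2) * (a + i + 2))
    have h0 := hw 0 (by omega)
    have h1 := hw (i + 1) (by omega)
    simp only [idealConfig_delimited, true_or, or_true, if_true, totSequence_eq_one,
      add_zero] at h0 h1
    have hk : a + i + 2 ≤ n.sqrt := Nat.le_sqrt.2 hn
    have hle := Nat.unpair_left_le n.sqrt
    have hs : (n + (i + 1)).sqrt = n.sqrt := by
      obtain ⟨r, hr, hr'⟩ : ∃ r, n = n.sqrt * n.sqrt + r ∧ r ≤ n.sqrt + 1 := by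
        rcases h0.2 with h | h
        · exact ⟨0, h, by omega⟩
        · exact ⟨n.sqrt.unpair.1 + 1, h, by omega⟩
      rw [show n + (i + 1) = n.sqrt * n.sqrt + (r + (i + 1)) by omega]
      exact sqrt_mul_self_add (by omega)
    rw [hs] at h1
    exact ⟨n.sqrt, by omega, h0.1, by omega⟩

/-! ### The map driven by a sequence and its limit sets -/

theorem frequently_cylinder_of_mapClusterPt {u : ℕ → Config} {y : Config}
    (h : MapClusterPt y atTop u) (N : ℕ) : ∃ᶠ n in atTop, ∀ k < N, u n k = y k := by
  refine mapClusterPt_iff_frequently.1 h {z | ∀ k < N, z k = y k} ?_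
  exact (PiNat.isOpen_cylinder _ y N).mem_nhds fun _ _ => rfl

theorem mapClusterPt_config_iff {u : ℕ → Config} {y : Config} :
    MapClusterPt y atTop u ↔ ∀ N, ∃ᶠ n in atTop, ∀ k < N, u n k = y k := by
  refine ⟨frequently_cylinder_of_mapClusterPt, fun h => mapClusterPt_iff_frequently.2 ?_⟩
  intro s hs
  let _ : MetricSpace Config := PiNat.metricSpace
  obtain ⟨r, hr, hrs⟩ := Metric.mem_nhds_iff.1 hs
  obtain ⟨N, hN⟩ := exists_pow_lt_of_lt_one hr (by norm_num : (1 / 2 : ℝ) < 1)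
  exact (h N).mono fun n hn => hrs ((PiNat.mem_cylinder_iff_dist_le.1 hn).trans_lt hN)

/-- The words of `y` all occur infinitely often in `v`. -/
def limitSubshift (v : ℕ → Fin 3) : Set Config :=
  {y | ∀ N, ∃ᶠ n in atTop, ∀ k < N, v (n + k) = y k}

theorem limitSubshift_eq_mapClusterPt (v : ℕ → Fin 3) :
    limitSubshift v = {y | MapClusterPt y atTop fun n k => v (n + k)} := by
  ext y
  exact mapClusterPt_config_iff.symm

theorem isClosed_limitSubshift (v : ℕ → Fin 3) : IsClosed (limitSubshift v) := by
  rw [limitSubshift_eq_mapClusterPt]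
  exact isClosed_setOfPred_clusterPt

theorem shift_mem_limitSubshift {v : ℕ → Fin 3} {y : Config} (hy : y ∈ limitSubshift v) :
    shift y ∈ limitSubshift v := fun N => by
  have h := hy (N + 1)
  rw [frequently_atTop] at h ⊢
  intro a
  obtain ⟨n, hn, hk⟩ := h a
  refine ⟨n + 1, by omega, fun k hkN => ?_⟩
  rw [add_assoc, add_comm 1]
  exact hk (k + 1) (by omega)

/-- Pigeonhole on the letter preceding y: were all three extensions to fail, each would fail on a
prefix absent from some index on, but a late occurrence of a long prefix of y is preceded by some
letter of v. -/
theorem exists_shift_eq_of_mem_limitSubshift {v : ℕ → Fin 3} {y : Config}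
    (hy : y ∈ limitSubshift v) : ∃ z ∈ limitSubshift v, shift z = y := by
  let cons : Fin 3 → Config := fun s k => Nat.casesOn k s y
  by_contra! hcon
  have hs : ∀ s, ∃ N, ∀ᶠ n in atTop, ¬ ∀ k < N, v (n + k) = cons s k := fun s => by
    by_contra! h
    exact hcon (cons s) h rfl
  choose N hN using hs
  have hev : ∀ᶠ n in atTop, ∀ s, ¬ ∀ k < N s, v (n + k) = cons s k := eventually_all.2 hN
  obtain ⟨a, ha⟩ := eventually_atTop.1 hev
  obtain ⟨n, hn, hk⟩ := frequently_atTop.1 (hy (Finset.univ.sup N)) (a + 1)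
  obtain ⟨n, rfl⟩ : ∃ l, n = l + 1 := ⟨n - 1, by omega⟩
  refine ha n (by omega) (v n) fun k hkN => ?_
  rcases k with _ | k
  · rfl
  · have := Finset.le_sup (f := N) (Finset.mem_univ (v n))
    have hy' := hk k (by omega)
    rwa [add_assoc, add_comm 1] at hy'

theorem limitSubshift_ne_two {v : ℕ → Fin 3} (hv : ∀ n, v n ≠ 2) {y : Config}
    (hy : y ∈ limitSubshift v) (k : ℕ) : y k ≠ 2 := by
  obtain ⟨n, hn⟩ := (hy (k + 1)).exists
  exact hn k (Nat.lt_succ_self k) ▸ hv _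

/-- The letter `2` delimits a prefix `w`; the map shifts `w` and appends to it two letters of `v`
that are determined by its length. -/
def appendShift (v : ℕ → Fin 3) (x : Config) : Config := fun k =>
  if ∃ l < k, x l = 2 then 2
  -- With the first 2 at p, the two appended letters are v_{2p} at p - 1 (absent if p = 0) and
  -- v_{2p+1} at p; everything beyond p becomes 2.
  else if x k = 2 then v (2 * k + 1)
  else if x (k + 1) = 2 then v (2 * k + 2)
  else x (k + 1)

theorem appendShift_congr {v : ℕ → Fin 3} {x y : Config} {N : ℕ} (h : ∀ k < N + 1, x k = y k) :
    ∀ k < N, appendShift v x k = appendShift v y k := fun k hk => by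
  have e : (∃ l < k, x l = 2) ↔ ∃ l < k, y l = 2 :=
    exists_congr fun l => and_congr_right fun hl => by rw [h l (by omega)]
  simp only [appendShift, e, h k (by omega), h (k + 1) (by omega)]

theorem appendShift_of_ne_two (v : ℕ → Fin 3) {x : Config} (hx : ∀ k, x k ≠ 2) :
    appendShift v x = shift x := by
  ext k
  simp [appendShift, hx, shift]

theorem image_appendShift_limitSubshift {v : ℕ → Fin 3} (hv : ∀ n, v n ≠ 2) :
    appendShift v '' limitSubshift v = limitSubshift v := by
  apply Set.Subset.antisymm
  · rintro _ ⟨y, hy, rfl⟩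
    rw [appendShift_of_ne_two v (limitSubshift_ne_two hv hy)]
    exact shift_mem_limitSubshift hy
  · intro y hy
    obtain ⟨z, hz, rfl⟩ := exists_shift_eq_of_mem_limitSubshift hy
    exact ⟨z, hz, appendShift_of_ne_two v (limitSubshift_ne_two hv hz)⟩

/-- Let `p` be the first position of `2` in `x`. After `n` steps, the first `2` is at `p + n`, and
before it stands a factor of the sequence `w v_{2p} v_{2p+1} …`. -/
theorem iterate_appendShift {v : ℕ → Fin 3} (hv : ∀ n, v n ≠ 2) {x : Config} {p : ℕ}
    (hp : x p = 2) (hlt : ∀ l < p, x l ≠ 2) (n : ℕ) :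
    (appendShift v)^[n] x (p + n) = 2 ∧ (∀ l < p + n, (appendShift v)^[n] x l ≠ 2) ∧
      ∀ k < p + n, (appendShift v)^[n] x k = if n + k < p then x (n + k) else v (p + (n + k)) := by
  induction n with
  | zero => exact ⟨hp, hlt, fun k hk => by simp_all⟩
  | succ n ih =>
    obtain ⟨h1, h2, h3⟩ := ih
    have hval : ∀ k < p + (n + 1), (appendShift v)^[n + 1] x k =
        if n + 1 + k < p then x (n + 1 + k) else v (p + (n + 1 + k)) := fun k hk => by
      rw [Function.iterate_succ_apply', appendShift,
        if_neg (by rintro ⟨l, hl, he⟩; exact h2 l (by omega) he)]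
      rcases (by omega : k = p + n ∨ k + 1 = p + n ∨ k + 1 < p + n) with hk | hk | hk
      · rw [if_pos (hk ▸ h1), if_neg (by omega)]
        congr 1; omega
      · rw [if_neg (h2 k (by omega)), if_pos (hk ▸ h1), if_neg (by omega)]
        congr 1; omega
      · rw [if_neg (h2 k (by omega)), if_neg (h2 _ hk), h3 _ hk,
          show n + (k + 1) = n + 1 + k by omega]
    refine ⟨?_, fun l hl => ?_, hval⟩
    · rw [Function.iterate_succ_apply', appendShift, if_pos ⟨p + n, by omega, h1⟩]
    · rw [hval l hl]
      split_ifs with h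
      · exact hlt _ h
      · exact hv _

/-- From time p on, nothing of the initial word is left: the first n letters of the n-th iterate are
the window of v starting at n + p, so accumulation points are those of the windows of v. -/
theorem omegaSet_appendShift {v : ℕ → Fin 3} (hv : ∀ n, v n ≠ 2) {x : Config}
    (hx : ∃ n, x n = 2) : omegaSet (appendShift v) x = limitSubshift v := by
  classical
  have hp := Nat.find_spec hx
  have hlt : ∀ l < Nat.find hx, x l ≠ 2 := fun l hl => Nat.find_min hx hl
  generalize Nat.find hx = p at hp hlt
  have key : ∀ n k, p ≤ n → k < n → (appendShift v)^[n] x k = v (n + p + k) := fun n k hn hk => by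
    rw [(iterate_appendShift hv hp hlt n).2.2 k (by omega), if_neg (by omega)]
    congr 1; omega
  ext y
  refine mapClusterPt_config_iff.trans (forall_congr' fun N => ?_)
  simp only [frequently_atTop]
  constructor
  · intro h a
    obtain ⟨n, hn, hk⟩ := h (a + p + N)
    exact ⟨n + p, by omega, fun k hkN => by rw [← hk k hkN, key n k (by omega) (by omega)]⟩
  · intro h a
    -- One p is lost in passing from window index to time; the other ensures that the time is at
    -- least p.
    obtain ⟨n, hn, hk⟩ := h (a + 2 * p + N)
    obtain ⟨n, rfl⟩ : ∃ l, n = l + p := ⟨n - p, by omega⟩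
    exact ⟨n, by omega, fun k hkN => by rw [← hk k hkN, key n k (by omega) (by omega)]⟩

/-! ### Attractors from a typical limit set -/

theorem realm_inter {X : Type} [TopologicalSpace X] (T : X → X) (A B : Set X) :
    realm T (A ∩ B) = realm T A ∩ realm T B := by
  ext x
  exact Set.subset_inter_iff

/-- The realm of A ∩ B is comeagre, hence not meagre in a nonempty Baire space, so A ∩ B cannot be a
proper subset of A or of B. -/
theorem isTopologicalAttractor_unique {X : Type} [TopologicalSpace X] [BaireSpace X] [Nonempty X]
    {T : X → X} {A B : Set X} (hA : IsTopologicalAttractor T A) (hB : IsTopologicalAttractor T B) :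
    B = A := by
  have key : ∀ {A B : Set X}, IsTopologicalAttractor T A → IsTopologicalAttractor T B → A ⊆ B := by
    intro A B hA hB
    by_contra h
    have hss : A ∩ B ⊂ A := Set.inter_subset_left.ssubset_of_ne fun e => h (Set.inter_eq_left.1 e)
    have hm := hA.2.2 _ (hA.1.inter hB.1) hss
    rw [realm_inter] at hm
    have hr := inter_mem (inter_mem hA.2.1 hB.2.1) hm
    rw [Set.inter_compl_self] at hr
    simpa using (dense_of_mem_residual hr).nonempty
  exact (key hB hA).antisymm (key hA hB)

theorem isMetricAttractor_unique {X : Type} [TopologicalSpace X] [MeasurableSpace X]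
    {μ : Measure X} [IsProbabilityMeasure μ] {T : X → X} {A B : Set X}
    (hA : IsMetricAttractor μ T A) (hB : IsMetricAttractor μ T B) : B = A := by
  have key : ∀ {A B : Set X}, IsMetricAttractor μ T A → IsMetricAttractor μ T B → A ⊆ B := by
    intro A B hA hB
    by_contra h
    have hss : A ∩ B ⊂ A := Set.inter_subset_left.ssubset_of_ne fun e => h (Set.inter_eq_left.1 e)
    have hm := hA.2.2 _ (hA.1.inter hB.1) hss
    rw [realm_inter] at hm
    obtain ⟨x, ⟨h1, h2⟩, h3⟩ := ((hA.2.1.and hB.2.1).and (measure_eq_zero_iff_ae_notMem.1 hm)).exists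
    exact h3 ⟨h1, h2⟩
  exact (key hB hA).antisymm (key hA hB)

theorem isTopologicalAttractor_of_omegaSet_eq {X : Type} [TopologicalSpace X] {T : X → X}
    {A : Set X} (hA : IsClosed A) (h : {x | omegaSet T x = A} ∈ residual X) :
    IsTopologicalAttractor T A :=
  ⟨hA, mem_of_superset h fun _ hx => Eq.subset hx, fun _ _ hss =>
    mem_of_superset h fun _ hx hx' => hss.2 ((Eq.superset hx).trans hx')⟩

theorem isMetricAttractor_of_omegaSet_eq {X : Type} [TopologicalSpace X] [MeasurableSpace X]
    {μ : Measure X} {T : X → X} {A : Set X} (hA : IsClosed A) (h : ∀ᵐ x ∂μ, omegaSet T x = A) :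
    IsMetricAttractor μ T A :=
  ⟨hA, h.mono fun _ hx => hx.subset, fun _ _ hss =>
    measure_eq_zero_iff_ae_notMem.2 (h.mono fun _ hx hx' => hss.2 (hx.superset.trans hx'))⟩

theorem isOpen_exists_eq_two : IsOpen {x : Config | ∃ n, x n = 2} := by
  simp only [Set.ofPred_exists]
  exact isOpen_iUnion fun n =>
    (isOpen_discrete {(2 : Fin 3)}).preimage (continuous_apply n : Continuous fun x : Config => x n)

theorem dense_exists_eq_two : Dense {x : Config | ∃ n, x n = 2} := by
  intro x
  refine mem_closure_of_tendsto (f := fun n : ℕ => Function.update x n 2) (b := atTop) ?_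
    (Eventually.of_forall fun n => ⟨n, by simp⟩)
  refine tendsto_pi_nhds.2 fun k => tendsto_const_nhds.congr' ?_
  filter_upwards [eventually_gt_atTop k] with n hn
  rw [Function.update_of_ne hn.ne]

/-- The event contains its shift preimage, so ergodicity makes it null or conull; being open and
nonempty, it is not null. -/
theorem ae_exists_eq_two {μ : Measure Config} [IsProbabilityMeasure μ] (hμ : Ergodic shift μ)
    [μ.IsOpenPosMeasure] : ∀ᵐ x ∂μ, ∃ n, x n = 2 := by
  have hE : MeasurableSet {x : Config | ∃ n, x n = 2} := by
    simp only [Set.ofPred_exists]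
    exact MeasurableSet.iUnion fun n => measurable_pi_apply n (measurableSet_singleton 2)
  have hsub : shift ⁻¹' {x : Config | ∃ n, x n = 2} ⊆ {x | ∃ n, x n = 2} :=
    fun _ ⟨n, hn⟩ => ⟨n + 1, hn⟩
  rcases hμ.ae_empty_or_univ_of_preimage_ae_le hE.nullMeasurableSet
    (LE.le.eventuallyLE hsub) with h | h
  · refine absurd (ae_eq_empty.1 h) (isOpen_exists_eq_two.measure_ne_zero μ ?_)
    exact ⟨fun _ => 2, 0, rfl⟩
  · exact eventuallyEq_univ.1 h

/-! ### Effectivity of the map and of the limit set -/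

theorem computableMap_appendShift {v : ℕ → Fin 3} (hv : Primrec v) :
    symbolicSpace.ComputableMap symbolicSpace (appendShift v) := by
  classical
  have happ : Primrec fun p : ℕ × ℕ => appendShift v (idealConfig p.1) p.2 := by
    have hex : PrimrecRel fun (k i : ℕ) => ∃ l < k, idealConfig i l = 2 :=
      PrimrecRel.exists_lt (R := fun l i => idealConfig i l = 2)
        (Primrec.eq.comp (primrec₂_idealConfig.comp Primrec.snd Primrec.fst) (Primrec.const 2))
    have h2k : Primrec fun p : ℕ × ℕ => 2 * p.2 :=
      Primrec.nat_mul.comp (Primrec.const 2) Primrec.snd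
    have hk1 : Primrec fun p : ℕ × ℕ => idealConfig p.1 (p.2 + 1) :=
      primrec₂_idealConfig.comp Primrec.fst (Primrec.succ.comp Primrec.snd)
    refine (Primrec.ite (hex.comp Primrec.snd Primrec.fst) (Primrec.const 2)
      (Primrec.ite (Primrec.eq.comp primrec₂_idealConfig (Primrec.const 2))
        (hv.comp (Primrec.succ.comp h2k))
        (Primrec.ite (Primrec.eq.comp hk1 (Primrec.const 2))
          (hv.comp (Primrec.succ.comp (Primrec.succ.comp h2k))) hk1))).of_eq fun p => ?_
    simp only [appendShift, Nat.succ_eq_add_one]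
  have hp : Primrec fun m : ℕ => m.unpair.2.unpair.1 :=
    Primrec.fst.comp (Primrec.unpair.comp (Primrec.snd.comp Primrec.unpair))
  have hq : Primrec fun m : ℕ => m.unpair.2.unpair.2 :=
    Primrec.snd.comp (Primrec.unpair.comp (Primrec.snd.comp Primrec.unpair))
  have hc : Primrec fun m : ℕ => m.unpair.1 := Primrec.fst.comp Primrec.unpair
  have hR : PrimrecRel fun (k : ℕ) (p : ℕ × ℕ) =>
      p.1.unpair.2.unpair.2 + 1 < 2 ^ k * (p.1.unpair.2.unpair.1 + 1) ∨
        appendShift v (idealConfig p.2.unpair.1) k = idealConfig p.1.unpair.1 k := by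
    have hm : Primrec fun r : ℕ × ℕ × ℕ => r.2.1 := Primrec.fst.comp Primrec.snd
    exact (Primrec.nat_lt.comp (Primrec.succ.comp (hq.comp hm))
        (Primrec.nat_mul.comp (primrec_two_pow.comp Primrec.fst)
          (Primrec.succ.comp (hp.comp hm)))).or
      (Primrec.eq.comp
        (happ.comp ((hc.comp (Primrec.snd.comp Primrec.snd)).pair Primrec.fst))
        (primrec₂_idealConfig.comp (hc.comp hm) Primrec.fst))
  have hR' := hR.forall_lt_param
  -- With q + 1 the denominator of the target radius, membership of the image uses its first q + 1
  -- letters, hence q + 2 letters of x: exactly those fixed by an open ball of radius 2^{-(q+1)}.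
  -- Testing its centre suffices.
  refine ⟨fun p => p.2.unpair.2 = Nat.pair 0 (2 ^ (p.1.unpair.2.unpair.2 + 1) - 1) ∧
    appendShift v (idealConfig p.2.unpair.1) ∈ symbolicSpace.idealBall p.1, ?_, fun m => ?_⟩
  · have hpred : PrimrecPred fun p : ℕ × ℕ =>
        p.2.unpair.2 = Nat.pair 0 (2 ^ (p.1.unpair.2.unpair.2 + 1) - 1) ∧
          appendShift v (idealConfig p.2.unpair.1) ∈ symbolicSpace.idealBall p.1 := by
      simp only [mem_idealBall_symbolicSpace]
      exact (Primrec.eq.comp (Primrec.snd.comp (Primrec.unpair.comp Primrec.snd))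
          (Primrec₂.natPair.comp (Primrec.const 0) (Primrec.nat_sub.comp
            (primrec_two_pow.comp (Primrec.succ.comp (hq.comp Primrec.fst)))
            (Primrec.const 1)))).and
        (hR'.comp (Primrec.succ.comp (hq.comp Primrec.fst)) Primrec.id)
    obtain ⟨_, h⟩ := hpred
    exact ComputablePred.to_re ⟨_, h.to_comp⟩
  · have hball : ∀ {x y : Config}, (∀ k ≤ m.unpair.2.unpair.2 + 1, x k = y k) →
        (appendShift v x ∈ symbolicSpace.idealBall m ↔
          appendShift v y ∈ symbolicSpace.idealBall m) := fun {x y} h => by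
      simp only [mem_idealBall_symbolicSpace]
      refine forall₂_congr fun k hk => ?_
      rw [appendShift_congr (fun l hl => h l (Nat.lt_succ_iff.1 hl)) k hk]
    ext x
    simp only [Set.mem_preimage, Set.mem_iUnion, Set.mem_ofPred_eq, exists_prop]
    constructor
    · intro hx
      obtain ⟨i, hi⟩ := idealConfig_approx (m.unpair.2.unpair.2 + 2) x
      have hxi : ∀ k ≤ m.unpair.2.unpair.2 + 1, x k = idealConfig i k :=
        fun k hk => (hi k (by omega)).symm
      refine ⟨cylinderIndex i (m.unpair.2.unpair.2 + 1), ⟨?_, ?_⟩,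
        mem_idealBall_cylinderIndex.2 hxi⟩
      · simp [cylinderIndex]
      · simpa [cylinderIndex] using (hball hxi).1 hx
    · rintro ⟨n, ⟨hn, hT⟩, hx⟩
      have e : n = cylinderIndex n.unpair.1 (m.unpair.2.unpair.2 + 1) := by
        rw [cylinderIndex, ← hn, Nat.pair_unpair]
      rw [e] at hx
      exact (hball (mem_idealBall_cylinderIndex.1 hx)).2 hT

theorem isClosed_closedIdealBall_symbolicSpace (m : ℕ) :
    IsClosed (symbolicSpace.closedIdealBall m) := by
  let _ : MetricSpace Config := PiNat.metricSpace
  exact Metric.isClosed_closedBall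

/-- One direction holds because a ball tests finitely many letters; the other takes a cluster point
of the windows in the ball, by compactness. -/
theorem closedIdealBall_inter_limitSubshift_nonempty {v : ℕ → Fin 3} {m : ℕ} :
    (symbolicSpace.closedIdealBall m ∩ limitSubshift v).Nonempty ↔
      ∃ᶠ n in atTop, (fun k => v (n + k)) ∈ symbolicSpace.closedIdealBall m := by
  constructor
  · rintro ⟨y, hym, hy⟩
    refine (hy (m.unpair.2.unpair.2 + 1)).mono fun n hn => ?_
    rw [mem_closedIdealBall_symbolicSpace] at hym ⊢
    intro k hk
    rw [hn k hk]
    exact hym k hk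
  · intro h
    obtain ⟨y, hym, hy⟩ :=
      (isClosed_closedIdealBall_symbolicSpace m).isCompact.exists_mapClusterPt_of_frequently h
    exact ⟨y, hym, mapClusterPt_config_iff.1 hy⟩

theorem isPiTwo_limitSubshift {v : ℕ → Fin 3} (hv : Primrec v) :
    symbolicSpace.IsPiTwo (limitSubshift v) := by
  refine ⟨(isClosed_limitSubshift v).isCompact, ?_⟩
  have hp : Primrec fun m : ℕ => m.unpair.2.unpair.1 :=
    Primrec.fst.comp (Primrec.unpair.comp (Primrec.snd.comp Primrec.unpair))
  have hq : Primrec fun m : ℕ => m.unpair.2.unpair.2 :=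
    Primrec.snd.comp (Primrec.unpair.comp (Primrec.snd.comp Primrec.unpair))
  have hR : PrimrecRel fun (k : ℕ) (p : ℕ × ℕ × ℕ) =>
      p.1.unpair.2.unpair.2 + 1 ≤ 2 ^ k * (p.1.unpair.2.unpair.1 + 1) ∨
        v (p.2.1 + p.2.2 + k) = idealConfig p.1.unpair.1 k := by
    have hm : Primrec fun r : ℕ × ℕ × ℕ × ℕ => r.2.1 := Primrec.fst.comp Primrec.snd
    have hab : Primrec fun r : ℕ × ℕ × ℕ × ℕ => r.2.2 := Primrec.snd.comp Primrec.snd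
    exact (Primrec.nat_le.comp (Primrec.succ.comp (hq.comp hm))
        (Primrec.nat_mul.comp (primrec_two_pow.comp Primrec.fst)
          (Primrec.succ.comp (hp.comp hm)))).or
      (Primrec.eq.comp
        (hv.comp (Primrec.nat_add.comp
          (Primrec.nat_add.comp (Primrec.fst.comp hab) (Primrec.snd.comp hab)) Primrec.fst))
        (primrec₂_idealConfig.comp ((Primrec.fst.comp Primrec.unpair).comp hm) Primrec.fst))
  have hR' := hR.forall_lt_param
  have hpred : PrimrecPred fun p : ℕ × ℕ × ℕ =>
      ¬ (fun k => v (p.2.1 + p.2.2 + k)) ∈ symbolicSpace.closedIdealBall p.1 := by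
    simp only [mem_closedIdealBall_symbolicSpace]
    exact (hR'.comp (Primrec.succ.comp (hq.comp Primrec.fst)) Primrec.id).not
  obtain ⟨_, h⟩ := hpred
  refine ⟨_, h.to_comp, fun m => ?_⟩
  change _ ∩ _ = ∅ ↔ _
  rw [← Set.not_nonempty_iff_eq_empty, closedIdealBall_inter_limitSubshift_nonempty,
    not_frequently, eventually_atTop]
  simp only [decide_eq_true_eq]
  refine exists_congr fun a => ⟨fun h b => h _ (Nat.le_add_right a b), fun h b hb => ?_⟩
  have := h (b - a)
  rwa [Nat.add_sub_cancel' hb] at this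

/-! ### Completeness -/

/-- `Tot` is `Π₂`-hard. -/
theorem exists_computable_mem_iff_notMem_tot {S : Set ℕ} (hS : IsSigmaTwoSet S) :
    ∃ r : ℕ → ℕ, Computable r ∧ ∀ i, i ∈ S ↔ r i ∉ Tot := by
  obtain ⟨f, hf, hS⟩ := hS
  -- On input ⟨i, a⟩, search for a b refuting f (i, a, b) = 1. With i fixed by currying, the program
  -- is total iff every a is refuted, that is, iff i ∉ S.
  have hpart : Partrec fun x : ℕ =>
      Nat.rfind fun b => Part.some (!f (x.unpair.1, x.unpair.2, b)) := by
    refine Partrec.rfind (p := fun (x b : ℕ) => Part.some (!f (x.unpair.1, x.unpair.2, b)))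
      (Computable.partrec (f := fun p : ℕ × ℕ => !f (p.1.unpair.1, p.1.unpair.2, p.2)) ?_).to₂
    exact Primrec.not.to_comp.comp (hf.comp (Primrec.to_comp
      ((Primrec.fst.comp (Primrec.unpair.comp Primrec.fst)).pair
        ((Primrec.snd.comp (Primrec.unpair.comp Primrec.fst)).pair Primrec.snd))))
  obtain ⟨c, hc⟩ := Nat.Partrec.Code.exists_code.1 (Partrec.nat_iff.1 hpart)
  refine ⟨fun i => Encodable.encode (Nat.Partrec.Code.curry c i), ?_, fun i => ?_⟩
  · exact (Primrec.encode.comp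
      (Nat.Partrec.Code.primrec₂_curry.comp (Primrec.const c) Primrec.id)).to_comp
  · rw [hS]
    have hdom : ∀ a, (Nat.rfind fun b => Part.some (!f (i, a, b))).Dom ↔ ∃ b, f (i, a, b) = false :=
      fun a => Nat.rfind_dom.trans <| exists_congr fun b =>
        ⟨fun h => by simpa using h.1, fun h => ⟨by simp [h], fun _ => trivial⟩⟩
    simp only [Tot, Set.mem_ofPred_eq, Denumerable.ofNat_encode, Nat.Partrec.Code.eval_curry, hc,
      Nat.unpair_pair, hdom]
    push Not
    simp

/-- Composing the two reductions through `Tot` gives a many-one reduction between outer collections,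
so axioms with a single premise suffice. -/
theorem isPiTwoComplete_of_manyOneReducible {X : Type} {C : ComputableMetricSpace X} {K : Set X}
    (hK : C.IsPiTwo K) (h : ManyOneReducible (fun i : ℕ => i ∈ Tot)
      (fun m : ℕ => (C.closedIdealBall m ∩ K).Nonempty)) : C.IsPiTwoComplete K := by
  refine ⟨hK, fun Y D K' hK' => ?_⟩
  obtain ⟨g, hg, hgm⟩ := h
  obtain ⟨r, hr, hrm⟩ := exists_computable_mem_iff_notMem_tot hK'.2
  have hout : ∀ n, n ∈ D.outer K' ↔ g (r n) ∈ C.outer K := fun n => by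
    rw [hrm, show r n ∈ Tot ↔ _ from hgm (r n), Set.not_nonempty_iff_eq_empty]
    rfl
  refine ⟨fun p => p.2 = [g (r p.1)], ?_, fun n => by simp [hout]⟩
  refine ComputablePred.to_re ⟨inferInstance, ?_⟩
  exact Primrec.eq.decide.to_comp.comp Computable.snd
    (Computable.list_cons.comp (hg.comp (hr.comp Computable.fst)) (Computable.const []))

theorem tot_manyOneReducible : ManyOneReducible (fun i : ℕ => i ∈ Tot)
    (fun m : ℕ => (symbolicSpace.closedIdealBall m ∩ limitSubshift totSequence).Nonempty) := by
  refine ⟨fun i => cylinderIndex (1 + 3 ^ (i + 1)) (i + 2), Primrec.to_comp ?_, fun i => ?_⟩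
  · exact Primrec₂.natPair.comp
      (Primrec.nat_add.comp (Primrec.const 1) (primrec_three_pow.comp Primrec.succ))
      (Primrec₂.natPair.comp (Primrec.const 0) (Primrec.nat_sub.comp
        (primrec_two_pow.comp (Primrec.succ.comp Primrec.succ)) (Primrec.const 1)))
  · beta_reduce
    rw [closedIdealBall_inter_limitSubshift_nonempty, mem_tot_iff_frequently_totSequence]
    simp only [mem_closedIdealBall_cylinderIndex]

theorem mainTheorem3 :
    ∃ (T : Config → Config) (A : Set Config),
      symbolicSpace.ComputableMap symbolicSpace T ∧
      IsSubshift A ∧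
      T '' A = A ∧
      symbolicSpace.IsPiTwoComplete A ∧
      ManyOneReducible (fun i : ℕ => i ∈ Tot)
        (fun m : ℕ => (symbolicSpace.closedIdealBall m ∩ A).Nonempty) ∧
      (IsTopologicalAttractor T A ∧ ∀ B : Set Config, IsTopologicalAttractor T B → B = A) ∧
      (∀ μ : MeasureTheory.Measure Config, MeasureTheory.IsProbabilityMeasure μ →
        Ergodic shift μ → μ.IsOpenPosMeasure →
        (IsMetricAttractor μ T A ∧ ∀ B : Set Config, IsMetricAttractor μ T B → B = A)) := by
  have hclosed := isClosed_limitSubshift totSequence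
  have homega : ∀ x : Config, (∃ n, x n = 2) →
      omegaSet (appendShift totSequence) x = limitSubshift totSequence :=
    fun _ => omegaSet_appendShift totSequence_ne_two
  have htop : IsTopologicalAttractor (appendShift totSequence) (limitSubshift totSequence) :=
    isTopologicalAttractor_of_omegaSet_eq hclosed <| mem_of_superset
      (residual_of_dense_open isOpen_exists_eq_two dense_exists_eq_two) homega
  refine ⟨appendShift totSequence, limitSubshift totSequence,
    computableMap_appendShift primrec_totSequence,
    ⟨hclosed, fun _ => shift_mem_limitSubshift⟩,
    image_appendShift_limitSubshift totSequence_ne_two,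
    isPiTwoComplete_of_manyOneReducible (isPiTwo_limitSubshift primrec_totSequence)
      tot_manyOneReducible,
    tot_manyOneReducible, ⟨htop, fun _ => isTopologicalAttractor_unique htop⟩,
    fun μ _ hμ _ => ?_⟩
  have hmet : IsMetricAttractor μ (appendShift totSequence) (limitSubshift totSequence) :=
    isMetricAttractor_of_omegaSet_eq hclosed ((ae_exists_eq_two hμ).mono homega)
  exact ⟨hmet, fun _ => isMetricAttractor_unique hmet⟩
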